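/- Conventions. Graphs are finite, simple and undirected, $[q]=\{1,\dots,q\}$ is the set of colors, and $n=|V|$ for a graph $G=(V,E)$. The $q$-state Potts model with activity $\beta$ gives a configuration $c\in[q]^V$ the weight $w_G(c)=\beta^{\#\{uw\in E\,:\,c(u)=c(w)\}}$ (with $0^0=1$). An instance is a triple $\Omega=(G,\Lambda,\sigma)$ with $\Lambda\subseteq V$ and $\sigma\in[q]^\Lambda$; put $w_\Omega(c)=w_G(c)$ if $c$ agrees with $\sigma$ on $\Lambda$ and $w_\Omega(c)=0$ otherwise. The instance is feasible if $w_\Omega(c)>0$ for some $c$; in that case $\Pr_\Omega[c(v)=x]$ denotes the probability that the vertex $v$ has color $x$ under the Gibbs measure $c\mapsto w_\Omega(c)/\sum_{c'}w_\Omega(c')$. Write $\mathrm{dist}(v,S)$ for the minimum graph distance in $G$ from $v$ to a vertex of $S$; it is $\infty$ if there is no vertex of $S$ in the component of $v$, and then $\gamma^{\infty}=\exp(-\infty)=0$. Contraction functions. For $\delta:\mathbb N\to\mathbb R^+$, a vertex $v$ of $G$ and $\ell\ge 1$ let $$\mathcal E_\delta(v,\ell)=\sum_{(v,v_1,\dots,v_\ell)}\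 \prod_{i=1}^{\ell}\delta(\deg_G v_i),$$ where the sum is over all self-avoiding walks of length $\ell$ in $G$ starting at $v$. The function $\delta$ is a contraction function for a family $\mathcal G$ of finite graphs if there are constants $C>0$ and $0<\gamma<1$ such that $\mathcal E_\delta(v,\ell)<n^{C}\gamma^{\ell}$ for every $G=(V,E)\in\mathcal G$, every $v\in V$ and every $\ell\ge1$. Strong spatial mixing. The $q$-state Potts model with activity $\beta$ exhibits strong spatial mixing on $\mathcal G$ if there are constants $C>0$ and $0<\gamma<1$ such that for every $G=(V,E)\in\mathcal G$, $v\in V$, $\Lambda\subseteq V$, $x\in[q]$ and all $\sigma,\tau\in[q]^\Lambda$ for which $\Omega_1=(G,\Lambda,\sigma)$ and $\Omega_2=(G,\Lambda,\tau)$ are feasible, $$\bigl|\Pr\nolimits_{\Omega_1}[c(v)=x]-\Pr\nolimits_{\Omega_2}[c(v)=x]\bigr|\le n^{C}\gamma^{\mathrm{dist}(v,\Delta)},\qquad \Delta=\{u\in\Lambda:\sigma(u)\ne\tau(u)\}.$$ Theorem. Let $q\ge 3$ be an integer, let $0\le\beta<1$, and let $$\delta(d)=\begin{cases}\dfrac{2(1-\beta)}{q-1-(1-\beta)d}&\text{if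 }d\le\dfrac{q-1}{1-\beta}-2,\\[2mm]1&\text{otherwise.}\end{cases}$$ Let $\mathcal G$ be a family of finite graphs for which $\delta$ is a contraction function; if $\beta=0$, assume also that every graph in $\mathcal G$ is $q$-colorable. Then the $q$-state Potts model with activity $\beta$ exhibits strong spatial mixing on $\mathcal G$. Moreover, there are constants $C_1,C_2>0$ such that for every $G=(V,E)\in\mathcal G$, every $v\in V$, every $x\in[q]$, every $\Lambda\subseteq V\setminus\{v\}$ and all $\rho,\pi\in[q]^\Lambda$ for which $\Omega_1=(G,\Lambda,\rho)$ and $\Omega_2=(G,\Lambda,\pi)$ are feasible, $$\bigl|\Pr\nolimits_{\Omega_1}[c(v)=x]-\Pr\nolimits_{\Omega_2}[c(v)=x]\bigr|\le n^{C_1}\exp\bigl(-C_2\,\mathrm{dist}(v,\Delta)\bigr),$$ where $\Delta\subseteq\Lambda$ is the set of vertices on which $\rho$ and $\pi$ differ. -/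

import Mathlib

namespace Potts

noncomputable section

open Classical in
/-- The number of (undirected) edges of `G` that are monochromatic under the configuration `c`. -/
def numMono {V : Type*} [Fintype V] {q : ℕ} (G : SimpleGraph V) (c : V → Fin q) : ℕ :=
  (G.edgeFinset.filter fun e => (Sym2.map c e).IsDiag).card

/-- The weight `β ^ #mon(c)` of a configuration on the whole vertex set. -/
def graphWeight {V : Type*} [Fintype V] {q : ℕ} (β : ℝ) (G : SimpleGraph V) (c : V → Fin q) : ℝ :=
  β ^ numMono G c

/-- An instance `(G, Λ, σ)` of the `q`-state Potts model: a graph on `V`, a set `Λ` of fixed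
vertices and a configuration `σ ∈ [q]^Λ`. The colours are the elements of `Fin q`. -/
structure Instance (V : Type*) (q : ℕ) where
  /-- the underlying graph -/
  graph : SimpleGraph V
  /-- the set of fixed vertices -/
  fixed : Set V
  /-- the boundary configuration -/
  bdry : fixed → Fin q

namespace Instance

variable {V : Type*} [Fintype V] {q : ℕ}

open Classical in
/-- The weight of `c` in the instance: `β ^ #mon(c)` if `c` agrees with the boundary
configuration, and `0` otherwise. -/
def weight (Ω : Instance V q) (β : ℝ) (c : V → Fin q) : ℝ :=
  if ∀ u : Ω.fixed, c u = Ω.bdry u then graphWeight β Ω.graph c else 0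

/-- Some configuration has positive weight. -/
def Feasible (Ω : Instance V q) (β : ℝ) : Prop :=
  ∃ c : V → Fin q, 0 < Ω.weight β c

open Classical in
/-- The partition function. -/
def partitionFunction (Ω : Instance V q) (β : ℝ) : ℝ :=
  ∑ c : V → Fin q, Ω.weight β c

/-- The Gibbs measure (of a feasible instance), as a probability mass function. -/
def gibbs (Ω : Instance V q) (β : ℝ) (c : V → Fin q) : ℝ :=
  Ω.weight β c / Ω.partitionFunction β

open Classical in
/-- The marginal probability `Pr_Ω[c(v) = x]`. -/
def marginal (Ω : Instance V q) (β : ℝ) (v : V) (x : Fin q) : ℝ :=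
  ∑ c : V → Fin q with c v = x, Ω.gibbs β c

end Instance

/-- The set of vertices of `Λ` on which two configurations on `Λ` differ. -/
def disagreement {V : Type*} {q : ℕ} {Λ : Set V} (σ τ : Λ → Fin q) : Set V :=
  {u | ∃ h : u ∈ Λ, σ ⟨u, h⟩ ≠ τ ⟨u, h⟩}

/-- The graph distance from `v` to the set `S`; it is `⊤` if no vertex of `S` can be reached
from `v`, in particular if `S` is empty. -/
def distToSet {V : Type*} (G : SimpleGraph V) (v : V) (S : Set V) : ℕ∞ :=
  ⨅ u ∈ S, G.edist v u

open Classical in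
/-- `γ ^ ℓ` for `0 < γ < 1` and an extended natural number `ℓ`, with `γ ^ ∞ = 0`. -/
def powDecay (γ : ℝ) (ℓ : ℕ∞) : ℝ :=
  if ℓ = ⊤ then 0 else γ ^ ℓ.toNat

open Classical in
/-- `exp (-C ℓ)` for `C > 0` and an extended natural number `ℓ`, with `exp (-∞) = 0`. -/
def expDecay (C : ℝ) (ℓ : ℕ∞) : ℝ :=
  if ℓ = ⊤ then 0 else Real.exp (-(C * (ℓ.toNat : ℝ)))

/-- Strong spatial mixing of the `q`-state Potts model with activity `β` on a family
`(G i)` of finite graphs. -/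
def StrongSpatialMixing {ι : Type*} {V : ι → Type*} [∀ i, Fintype (V i)]
    (q : ℕ) (β : ℝ) (G : ∀ i, SimpleGraph (V i)) : Prop :=
  ∃ C γ : ℝ, 0 < C ∧ 0 < γ ∧ γ < 1 ∧
    ∀ (i : ι) (v : V i) (Λ : Set (V i)) (x : Fin q) (σ τ : Λ → Fin q),
      (Instance.mk (G i) Λ σ).Feasible β → (Instance.mk (G i) Λ τ).Feasible β →
      |(Instance.mk (G i) Λ σ).marginal β v x - (Instance.mk (G i) Λ τ).marginal β v x| ≤
        (Fintype.card (V i) : ℝ) ^ C * powDecay γ (distToSet (G i) v (disagreement σ τ))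

open Classical in
/-- `ℰ_δ(v, ℓ)`: the sum, over the self-avoiding walks `(v, v₁, …, v_ℓ)` of length `ℓ` in `G`
that start at `v`, of `∏_{i = 1}^{ℓ} δ(deg v_i)`. -/
def sawSum {V : Type*} [Fintype V] (G : SimpleGraph V) (δ : ℕ → ℝ) (v : V) (ℓ : ℕ) : ℝ :=
  ∑ u : V, ∑ p ∈ G.finsetWalkLength ℓ v u with p.IsPath,
    (p.support.tail.map fun w => δ (G.degree w)).prod

/-- The (positive) function `δ` is a contraction function for the family `(G i)` of finite
graphs. -/
def IsContractionFunction {ι : Type*} {V : ι → Type*} [∀ i, Fintype (V i)]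
    (δ : ℕ → ℝ) (G : ∀ i, SimpleGraph (V i)) : Prop :=
  (∀ d, 0 < δ d) ∧
  ∃ C γ : ℝ, 0 < C ∧ 0 < γ ∧ γ < 1 ∧
    ∀ (i : ι) (v : V i) (ℓ : ℕ), 1 ≤ ℓ →
      sawSum (G i) δ v ℓ < (Fintype.card (V i) : ℝ) ^ C * γ ^ ℓ

open Classical in
/-- The function `δ` attached to the `q`-state Potts model with activity `β`. -/
def delta (q : ℕ) (β : ℝ) (d : ℕ) : ℝ :=
  if (d : ℝ) ≤ ((q : ℝ) - 1) / (1 - β) - 2 then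
    2 * (1 - β) / ((q : ℝ) - 1 - (1 - β) * (d : ℝ))
  else 1

/-- `delta q β` is always positive when `β < 1`, as a contraction function has to be. -/
theorem delta_pos (q : ℕ) (β : ℝ) (hβ : β < 1) (d : ℕ) : 0 < delta q β d := by
  have h : 0 < 1 - β := by linarith
  unfold delta
  split_ifs with hd
  · have h1 : (d : ℝ) + 2 ≤ ((q : ℝ) - 1) / (1 - β) := by linarith
    rw [le_div_iff₀ h] at h1
    apply div_pos <;> nlinarith
  · exact one_pos

end

end Potts

/-! The proof is a correlation-decay recursion carried out on log-ratios of marginals. For `β > 0`,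
fixed vertices are deleted, and each edge from a deleted vertex to a remaining vertex `u` becomes a
pendant edge at `u` whose far end has a prescribed colour, recorded as an external field at `u`.
Comparing two colours `x`, `y` at `w` under two sets of fields then amounts to switching the pendant
edges at the neighbours of `w` from `x` to `y`, one neighbour at a time. Each switch depends on the
fields only through the marginal of that neighbour `u` in a graph without `w`, so the discrepancy at
`w` is at most the sum over `u` of a contraction factor times the discrepancy at `u`.

The factor comes from a uniform bound: the marginal of `u` never exceeds `1 / (q - (1 - β) deg u)`
(`mul_marginal_le_sum`), which makes the effect of a switch Lipschitz in the log-ratio with a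
constant at most `2(1 - β) / (q - 1 - (1 - β) deg u)` (`switch_le_of_marginal_le`). Where this is
not available the factor `1` always works (`switch_le_of_ratio`). Unrolling the recursion in
`ratio_le_exp_sum_walkSum` gives a sum over self-avoiding walks long enough to reach a difference of
the fields, which the contraction hypothesis makes exponentially small.

Positivity of the weights needs `β > 0`. The general bound follows by letting the activity decrease
to `β` with the walk sums of `delta q β` kept fixed. -/

namespace Potts

/-! ### Potts models with external fields; the uniform bound on marginals. -/

noncomputable section FieldModel

open scoped Classical

variable {V : Type*} {q : ℕ}

/-- The interaction of two colours along an edge. -/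
def agree (β : ℝ) (x y : Fin q) : ℝ := if x = y then β else 1

theorem agree_nonneg {β : ℝ} (hβ : 0 ≤ β) (x y : Fin q) : 0 ≤ agree β x y := by
  unfold agree; split_ifs <;> linarith

theorem agree_pos {β : ℝ} (hβ : 0 < β) (x y : Fin q) : 0 < agree β x y := by
  unfold agree; split_ifs <;> linarith

theorem agree_le_one {β : ℝ} (hβ : β ≤ 1) (x y : Fin q) : agree β x y ≤ 1 := by
  unfold agree; split_ifs <;> linarith

theorem sum_agree_mul (β : ℝ) (x : Fin q) (f : Fin q → ℝ) :
    ∑ z, agree β z x * f z = ∑ z, f z - (1 - β) * f x := by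
  have h : ∀ z, agree β z x * f z = f z - if z = x then (1 - β) * f z else 0 := by
    intro z; unfold agree; split_ifs <;> ring
  simp [h, Finset.sum_sub_distrib]

/-- The interaction along an edge in a configuration. -/
def edgeAgree (β : ℝ) (c : V → Fin q) (e : Sym2 V) : ℝ :=
  if (Sym2.map c e).IsDiag then β else 1

theorem edgeAgree_mk (β : ℝ) (c : V → Fin q) (u w : V) :
    edgeAgree β c s(u, w) = agree β (c u) (c w) := by
  simp [edgeAgree, agree]

variable [Fintype V]

/-- The weight of a configuration in the Potts model on the subgraph induced on `U`, with
external fields `b`. -/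
def fieldWeight (G : SimpleGraph V) (β : ℝ) (U : Finset V) (b : V → Fin q → ℝ)
    (c : V → Fin q) : ℝ :=
  (∏ u ∈ U, b u (c u)) * ∏ e ∈ G.edgeFinset with ∀ u ∈ e, u ∈ U, edgeAgree β c e

/-- The partition function on `U` with external fields `b` (up to a power of `q`, since the
configuration is summed over all of `V`). -/
def fieldZ (G : SimpleGraph V) (β : ℝ) (U : Finset V) (b : V → Fin q → ℝ) : ℝ :=
  ∑ c, fieldWeight G β U b c

/-- The external fields after each edge `wu` has been replaced by a pendant edge at `u`
whose other end has the colour `τ u`. -/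
def pin (G : SimpleGraph V) (β : ℝ) (w : V) (τ : V → Fin q) (b : V → Fin q → ℝ) :
    V → Fin q → ℝ :=
  fun u y => if G.Adj w u then agree β y (τ u) * b u y else b u y

variable {G : SimpleGraph V} {β : ℝ} {U : Finset V} {b b' : V → Fin q → ℝ} {w : V}

theorem fieldWeight_congr (h : ∀ u ∈ U, b u = b' u) (c : V → Fin q) :
    fieldWeight G β U b c = fieldWeight G β U b' c := by
  unfold fieldWeight
  rw [Finset.prod_congr rfl fun u hu => by rw [h u hu]]

theorem fieldZ_congr (h : ∀ u ∈ U, b u = b' u) : fieldZ G β U b = fieldZ G β U b' :=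
  Finset.sum_congr rfl fun c _ => fieldWeight_congr h c

theorem fieldWeight_congr_config {c c' : V → Fin q} (h : ∀ u ∈ U, c u = c' u) :
    fieldWeight G β U b c = fieldWeight G β U b c' := by
  unfold fieldWeight
  congr 1
  · exact Finset.prod_congr rfl fun u hu => by rw [h u hu]
  · refine Finset.prod_congr rfl fun e he => ?_
    rw [Finset.mem_filter] at he
    obtain ⟨-, he⟩ := he
    induction e with
    | h u w =>
      rw [edgeAgree_mk, edgeAgree_mk, h u (he u (by simp)), h w (he w (by simp))]

theorem fieldWeight_pin (τ : V → Fin q) (c : V → Fin q) :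
    fieldWeight G β U (pin G β w τ b) c =
      (∏ u ∈ U with G.Adj w u, agree β (c u) (τ u)) * fieldWeight G β U b c := by
  unfold fieldWeight
  rw [← mul_assoc, Finset.prod_filter (fun u => G.Adj w u), ← Finset.prod_mul_distrib]
  congr 1
  refine Finset.prod_congr rfl fun u _ => ?_
  unfold pin; split_ifs <;> simp

theorem fieldWeight_insert (hw : w ∉ U) (c : V → Fin q) :
    fieldWeight G β (insert w U) b c =
      b w (c w) * fieldWeight G β U (pin G β w (fun _ => c w) b) c := by
  rw [fieldWeight_pin]
  unfold fieldWeight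
  have hE : (G.edgeFinset.filter fun e => ∀ u ∈ e, u ∈ insert w U) =
      (G.edgeFinset.filter fun e => ∀ u ∈ e, u ∈ U) ∪
        (U.filter (G.Adj w)).image fun u => s(w, u) := by
    ext e
    induction e with
    | h u v =>
      simp only [Finset.mem_filter, Finset.mem_union, Finset.mem_image, Finset.mem_insert,
        SimpleGraph.mem_edgeFinset, SimpleGraph.mem_edgeSet, Sym2.mem_iff, forall_eq_or_imp,
        forall_eq, Sym2.eq_iff]
      constructor
      · rintro ⟨ha, rfl | hu, rfl | hv⟩
        · exact absurd ha (G.loopless.irrefl _)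
        · exact Or.inr ⟨v, ⟨hv, ha⟩, by simp⟩
        · exact Or.inr ⟨u, ⟨hu, ha.symm⟩, by simp⟩
        · exact Or.inl ⟨ha, hu, hv⟩
      · rintro (⟨ha, hu, hv⟩ | ⟨x, ⟨hx, ha⟩, ⟨rfl, rfl⟩ | ⟨rfl, rfl⟩⟩)
        · exact ⟨ha, Or.inr hu, Or.inr hv⟩
        · exact ⟨ha, Or.inl rfl, Or.inr hx⟩
        · exact ⟨ha.symm, Or.inr hx, Or.inl rfl⟩
  have hd : Disjoint (G.edgeFinset.filter fun e => ∀ u ∈ e, u ∈ U)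
      ((U.filter (G.Adj w)).image fun u => s(w, u)) := by
    rw [Finset.disjoint_left]
    intro e he he'
    obtain ⟨u, -, rfl⟩ := Finset.mem_image.1 he'
    exact hw ((Finset.mem_filter.1 he).2 w (by simp))
  rw [Finset.prod_insert hw, hE, Finset.prod_union hd,
    Finset.prod_image fun x _ y _ h => Sym2.congr_right.1 h]
  simp only [edgeAgree_mk]
  have : ∀ u, agree β (c w) (c u) = agree β (c u) (c w) := fun u => by
    simp [agree, eq_comm]
  simp only [this]
  ring

/-- This is the deletion step of the recursion. Both partition functions sum over colourings of all
of `V`, and the colour of `w` is idle once `w` is outside the vertex set; this accounts for the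
factor `q`. -/
theorem card_mul_fieldZ_insert (hw : w ∉ U) :
    (q : ℝ) * fieldZ G β (insert w U) b =
      ∑ x, b w x * fieldZ G β U (pin G β w (fun _ => x) b) := by
  have hF : ∀ (c : V → Fin q) (z x : Fin q),
      fieldWeight G β U (pin G β w (fun _ => x) b) (Function.update c w z) =
        fieldWeight G β U (pin G β w (fun _ => x) b) c := fun c z x =>
    fieldWeight_congr_config fun u hu => by
      rw [Function.update_of_ne]; rintro rfl; exact hw hu
  -- Exchanging the colour of `w` with an independent spare colour matches the two sums term by
  -- term.
  let φ : (V → Fin q) × Fin q ≃ (V → Fin q) × Fin q :=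
    Function.Involutive.toPerm (fun p => (Function.update p.1 w p.2, p.1 w)) (by
      rintro ⟨c, x⟩; simp)
  have h1 : ∑ x, b w x * fieldZ G β U (pin G β w (fun _ => x) b) =
      ∑ p : (V → Fin q) × Fin q, b w p.2 * fieldWeight G β U (pin G β w (fun _ => p.2) b) p.1 := by
    rw [Fintype.sum_prod_type_right]
    simp [fieldZ, Finset.mul_sum]
  have h2 : (q : ℝ) * fieldZ G β (insert w U) b = ∑ p : (V → Fin q) × Fin q,
      b w (p.1 w) * fieldWeight G β U (pin G β w (fun _ => p.1 w) b) p.1 := by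
    rw [Fintype.sum_prod_type]
    simp [fieldZ, Finset.mul_sum, fieldWeight_insert hw]
  rw [h1, h2, ← Equiv.sum_comp φ]
  refine Finset.sum_congr rfl fun p _ => ?_
  simp [φ, Function.Involutive.toPerm, hF]

theorem fieldWeight_nonneg (hβ : 0 ≤ β) (hb : ∀ u ∈ U, ∀ y, 0 ≤ b u y) (c : V → Fin q) :
    0 ≤ fieldWeight G β U b c := by
  refine mul_nonneg (Finset.prod_nonneg fun u hu => hb u hu _) (Finset.prod_nonneg fun e _ => ?_)
  unfold edgeAgree; split_ifs <;> linarith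

theorem fieldZ_pos [NeZero q] (hβ : 0 < β) (hb : ∀ u ∈ U, ∀ y, 0 < b u y) :
    0 < fieldZ G β U b := by
  refine Finset.sum_pos (fun c _ => ?_) ⟨fun _ => 0, Finset.mem_univ _⟩
  refine mul_pos (Finset.prod_pos fun u hu => hb u hu _) (Finset.prod_pos fun e _ => ?_)
  unfold edgeAgree; split_ifs <;> linarith

/-! ### Admissible fields -/

/-- The fields `b` on `U` take values in `(0, 1]` and are no stronger than what the edges of `G`
leaving `U` can produce. -/
def Admissible (G : SimpleGraph V) (β : ℝ) (U : Finset V) (b : V → Fin q → ℝ) : Prop :=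
  ∀ u ∈ U, (∀ y, 0 < b u y ∧ b u y ≤ 1) ∧
    ∑ y, (1 - b u y) ≤ (1 - β) * ((G.degree u : ℝ) - (U.filter (G.Adj u)).card)

theorem sum_one_sub_agree_mul_le (hβ : β ≤ 1) (g : Fin q → ℝ) (z : Fin q) (hg : g z ≤ 1) :
    ∑ y, (1 - agree β y z * g y) ≤ ∑ y, (1 - g y) + (1 - β) := by
  rw [Finset.sum_sub_distrib, Finset.sum_sub_distrib, sum_agree_mul]
  nlinarith

/-- Deleting `w` turns one edge at each remaining neighbour into an outgoing edge, and this pays for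
one pendant edge of deficit at most `1 - β`. The disjunction also permits omitting the pendant edge
at a neighbour, as is needed when that neighbour is about to be summed out. -/
theorem Admissible.of_insert (hβ0 : 0 < β) (hβ1 : β ≤ 1) (hw : w ∉ U)
    (hb : Admissible G β (insert w U) b)
    (hb' : ∀ u ∈ U, b' u = b u ∨ G.Adj w u ∧ ∃ z, ∀ y, b' u y = agree β y z * b u y) :
    Admissible G β U b' := by
  intro u hu
  obtain ⟨h1, h2⟩ := hb u (Finset.mem_insert_of_mem hu)
  rcases hb' u hu with h | ⟨ha, z, hz⟩
  · rw [h]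
    refine ⟨h1, h2.trans ?_⟩
    have : 0 ≤ 1 - β := by linarith
    gcongr
    exact Finset.subset_insert _ _
  · have hc : ((insert w U).filter (G.Adj u)).card = (U.filter (G.Adj u)).card + 1 := by
      rw [Finset.filter_insert, if_pos ha.symm, Finset.card_insert_of_notMem]
      simp [hw]
    rw [hc] at h2
    push_cast at h2
    refine ⟨fun y => ?_, ?_⟩
    · rw [hz]
      exact ⟨mul_pos (agree_pos hβ0 _ _) (h1 y).1,
        mul_le_one₀ (agree_le_one hβ1 _ _) (h1 y).1.le (h1 y).2⟩
    · simp only [hz]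
      refine (sum_one_sub_agree_mul_le hβ1 _ z (h1 z).2).trans ?_
      linarith

theorem Admissible.pin (hβ0 : 0 < β) (hβ1 : β ≤ 1) (hw : w ∉ U)
    (hb : Admissible G β (insert w U) b) (τ : V → Fin q) :
    Admissible G β U (pin G β w τ b) := by
  refine hb.of_insert hβ0 hβ1 hw fun u _ => ?_
  by_cases h : G.Adj w u
  · exact Or.inr ⟨h, τ u, fun y => by simp [Potts.pin, h]⟩
  · exact Or.inl (by ext y; simp [Potts.pin, h])

theorem sum_one_sub_prod_agree_le {ι : Type*} (hβ0 : 0 ≤ β) (hβ1 : β ≤ 1) (T : Finset ι)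
    (c : ι → Fin q) (g : Fin q → ℝ) (hg0 : ∀ y, 0 ≤ g y) (hg1 : ∀ y, g y ≤ 1) :
    ∑ y, (1 - (∏ u ∈ T, agree β y (c u)) * g y) ≤ ∑ y, (1 - g y) + (1 - β) * T.card := by
  induction T using Finset.induction_on with
  | empty => simp
  | insert u T hu ih =>
    simp only [Finset.prod_insert hu, Finset.card_insert_of_notMem hu, mul_assoc]
    have hle : ∀ y, (∏ u ∈ T, agree β y (c u)) ≤ 1 := fun y =>
      Finset.prod_le_one (fun _ _ => agree_nonneg hβ0 _ _) fun _ _ => agree_le_one hβ1 _ _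
    refine (sum_one_sub_agree_mul_le hβ1 _ (c u)
      (mul_le_one₀ (hle _) (hg0 _) (hg1 _))).trans ?_
    push_cast
    linarith

/-- Condition on the colouring of `U`. The weight of each colour at `w` is at most `1`, while the
weights of all colours sum to at least `q - (1 - β) deg w`, since every edge at `w`, inside or
outgoing, removes at most `1 - β` from the total `q`. -/
theorem mul_marginal_le_sum (hβ0 : 0 < β) (hβ1 : β ≤ 1)
    (hb : Admissible G β (insert w U) b) (hd : 0 ≤ (q : ℝ) - (1 - β) * G.degree w) (x : Fin q) :
    ((q : ℝ) - (1 - β) * G.degree w) * (b w x * fieldZ G β U (pin G β w (fun _ => x) b)) ≤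
      ∑ y, b w y * fieldZ G β U (pin G β w (fun _ => y) b) := by
  obtain ⟨h1, h2⟩ := hb w (Finset.mem_insert_self _ _)
  have hf : (insert w U).filter (G.Adj w) = U.filter (G.Adj w) := by
    rw [Finset.filter_insert, if_neg (G.loopless.irrefl _)]
  rw [hf] at h2
  have hR : ∀ c : V → Fin q, 0 ≤ fieldWeight G β U b c := fieldWeight_nonneg hβ0.le
    fun u hu y => ((hb u (Finset.mem_insert_of_mem hu)).1 y).1.le
  have hx : b w x * fieldZ G β U (pin G β w (fun _ => x) b) ≤ ∑ c, fieldWeight G β U b c := by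
    unfold fieldZ
    rw [Finset.mul_sum]
    refine Finset.sum_le_sum fun c _ => ?_
    rw [fieldWeight_pin, ← mul_assoc]
    refine mul_le_of_le_one_left (hR c) (mul_le_one₀ (h1 x).2 ?_ ?_)
    · exact Finset.prod_nonneg fun _ _ => agree_nonneg hβ0.le _ _
    · exact Finset.prod_le_one (fun _ _ => agree_nonneg hβ0.le _ _) fun _ _ => agree_le_one hβ1 _ _
  refine (mul_le_mul_of_nonneg_left hx hd).trans ?_
  unfold fieldZ
  simp only [Finset.mul_sum]
  rw [Finset.sum_comm]
  refine Finset.sum_le_sum fun c _ => ?_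
  simp only [fieldWeight_pin, ← mul_assoc]
  rw [← Finset.sum_mul]
  refine mul_le_mul_of_nonneg_right ?_ (hR c)
  have h3 := sum_one_sub_prod_agree_le hβ0.le hβ1 (U.filter (G.Adj w)) c (b w)
    (fun y => (h1 y).1.le) (fun y => (h1 y).2)
  have h4 : ∀ y, b w y * ∏ u ∈ U with G.Adj w u, agree β (c u) y =
      (∏ u ∈ U with G.Adj w u, agree β y (c u)) * b w y := fun y => by
    simp [agree, eq_comm, mul_comm]
  simp only [h4]
  simp only [Finset.sum_sub_distrib, Finset.sum_const, Finset.card_univ, Fintype.card_fin,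
    nsmul_eq_mul, mul_one] at h2 h3
  linarith

end FieldModel

end Potts

namespace Potts

/-! ### The contraction of log-ratios and its unrolling along walks. -/

noncomputable section Contraction

open scoped Classical

variable {V : Type*} {q : ℕ}

/-! ### Effect of switching the colour of a pendant edge -/

theorem switch_le_of_ratio {β t : ℝ} (hβ : 0 ≤ β) {f g : Fin q → ℝ}
    (h : ∀ z z', f z * g z' ≤ Real.exp t * (f z' * g z)) (x y : Fin q) :
    (∑ z, agree β z x * f z) * (∑ z, agree β z y * g z) ≤
      Real.exp t * ((∑ z, agree β z y * f z) * ∑ z, agree β z x * g z) := by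
  rw [mul_comm (∑ z, agree β z y * f z), Finset.sum_mul_sum, Finset.sum_mul_sum, Finset.mul_sum]
  refine Finset.sum_le_sum fun z _ => ?_
  rw [Finset.mul_sum]
  refine Finset.sum_le_sum fun z' _ => ?_
  have := mul_le_mul_of_nonneg_left (h z z')
    (mul_nonneg (agree_nonneg hβ z x) (agree_nonneg hβ z' y))
  linarith

/-- If the marginal `f x / ∑ f` of one vertex is at most `1 / m`, the probability that a pendant
edge with end colour `x` is satisfied depends Lipschitz-continuously on the log-marginal. -/
theorem sub_le_exp_mul_sub {a m t F G p r : ℝ} (ha : 0 ≤ a) (hm : a < m) (hF : 0 < F) (hG : 0 < G)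
    (hr0 : 0 < r) (hr : m * r ≤ G) (hp : 0 ≤ p) (ht : 0 ≤ t)
    (h : t < 1 → r * F ≤ Real.exp t * (G * p)) :
    (F - a * p) * G ≤ Real.exp (a / (m - a) * t) * (F * (G - a * r)) := by
  have hma : 0 < m - a := by linarith
  have hpos : 0 < G - a * r := by nlinarith
  -- For `t ≥ 1` this is trivial, so the hypothesis on ratios is needed only for `t < 1`.
  have key : r * F - p * G ≤ t * (r * F) := by
    rcases lt_or_ge t 1 with h1 | h1
    · have h2 := h h1
      have h3 : 1 - t ≤ Real.exp (-t) := by linarith [Real.add_one_le_exp (-t)]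
      have h4 : Real.exp (-t) * (r * F) ≤ G * p := by
        rw [Real.exp_neg, inv_mul_le_iff₀ (Real.exp_pos t)]; exact h2
      have h5 := mul_le_mul_of_nonneg_right h3 (mul_pos hr0 hF).le
      linarith
    · have := mul_nonneg hp hG.le
      have := mul_le_mul_of_nonneg_right h1 (mul_pos hr0 hF).le
      linarith
  -- Subtracting `a * r` from `m * r ≤ G` gives `(m - a) * r ≤ G - a * r`.
  have h6 : a * r ≤ a / (m - a) * (G - a * r) := by
    rw [div_mul_eq_mul_div, le_div_iff₀ hma]
    nlinarith [mul_le_mul_of_nonneg_left hr ha]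
  have h7 : a / (m - a) * t + 1 ≤ Real.exp (a / (m - a) * t) := Real.add_one_le_exp _
  refine le_trans ?_ (mul_le_mul_of_nonneg_right h7 (mul_pos hF hpos).le)
  have h8 := mul_le_mul_of_nonneg_left key ha
  have h9 := mul_le_mul_of_nonneg_left h6 (mul_nonneg ht hF.le)
  nlinarith

/-- The one-colour estimate is applied once for `x` and once, with `f` and `g` exchanged, for `y`.
Their product, after cancelling the two totals, gives the claim; this is the origin of the `2` in
the contraction factor. -/
theorem switch_le_of_marginal_le {β t m : ℝ} (hβ : β ≤ 1) (hm : 1 - β < m) (ht : 0 ≤ t)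
    {f g : Fin q → ℝ} (hf : ∀ z, 0 < f z) (hg : ∀ z, 0 < g z)
    (hmf : ∀ z, m * f z ≤ ∑ z', f z') (hmg : ∀ z, m * g z ≤ ∑ z', g z')
    (h : t < 1 → ∀ z z', f z * g z' ≤ Real.exp t * (f z' * g z)) (x y : Fin q) :
    (∑ z, agree β z x * f z) * (∑ z, agree β z y * g z) ≤
      Real.exp (2 * (1 - β) / (m - (1 - β)) * t) *
        ((∑ z, agree β z y * f z) * ∑ z, agree β z x * g z) := by
  have hF : 0 < ∑ z, f z := Finset.sum_pos (fun z _ => hf z) ⟨x, Finset.mem_univ _⟩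
  have hG : 0 < ∑ z, g z := Finset.sum_pos (fun z _ => hg z) ⟨x, Finset.mem_univ _⟩
  have ha : 0 ≤ 1 - β := by linarith
  have h1 := sub_le_exp_mul_sub (p := f x) (r := g x) ha hm hF hG (hg x) (hmg x) (hf x).le ht (by
    intro h1
    rw [Finset.mul_sum, Finset.sum_mul, Finset.mul_sum]
    refine Finset.sum_le_sum fun z _ => ?_
    linarith [h h1 z x])
  have h2 := sub_le_exp_mul_sub (p := g y) (r := f y) ha hm hG hF (hf y) (hmf y) (hg y).le ht (by
    intro h1
    rw [Finset.mul_sum, Finset.sum_mul, Finset.mul_sum]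
    refine Finset.sum_le_sum fun z _ => ?_
    linarith [h h1 y z])
  simp only [sum_agree_mul]
  have hfa : ∀ z, 0 ≤ ∑ z', f z' - (1 - β) * f z := fun z => by nlinarith [hmf z, hf z]
  have hga : ∀ z, 0 ≤ ∑ z', g z' - (1 - β) * g z := fun z => by nlinarith [hmg z, hg z]
  have h3 := mul_le_mul h1 h2 (mul_nonneg (hga y) hF.le) (mul_nonneg (Real.exp_pos _).le
    (mul_nonneg hF.le (hga x)))
  have he : Real.exp (2 * (1 - β) / (m - (1 - β)) * t) =
      Real.exp ((1 - β) / (m - (1 - β)) * t) * Real.exp ((1 - β) / (m - (1 - β)) * t) := by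
    rw [← Real.exp_add]; congr 1; ring
  rw [he]
  refine le_of_mul_le_mul_right ?_ (mul_pos hF hG)
  linarith

/-! ### Sums over self-avoiding walks -/

/-- The sum of the products of `δ` over the self-avoiding walks of length `ℓ` that start at `w` and
then stay in `U`. -/
def walkSum (G : SimpleGraph V) (δ : V → ℝ) : ℕ → Finset V → V → ℝ
  | 0, _, _ => 1
  | ℓ + 1, U, w => ∑ u ∈ U with G.Adj w u, δ u * walkSum G δ ℓ (U.erase u) u

theorem walkSum_nonneg (G : SimpleGraph V) {δ : V → ℝ} (hδ : ∀ u, 0 ≤ δ u) (ℓ : ℕ) (U : Finset V)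
    (w : V) : 0 ≤ walkSum G δ ℓ U w := by
  induction ℓ generalizing U w with
  | zero => exact zero_le_one
  | succ ℓ ih => exact Finset.sum_nonneg fun u _ => mul_nonneg (hδ u) (ih _ _)

theorem sum_Ico_walkSum_succ (G : SimpleGraph V) (δ : V → ℝ) (m n : ℕ) (U : Finset V) (w : V) :
    ∑ ℓ ∈ Finset.Ico (m + 1) (n + 1), walkSum G δ ℓ U w =
      ∑ u ∈ U with G.Adj w u, δ u * ∑ ℓ ∈ Finset.Ico m n, walkSum G δ ℓ (U.erase u) u := by
  rw [← Finset.sum_Ico_add' (fun ℓ => walkSum G δ ℓ U w) m n 1]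
  simp only [walkSum, Finset.mul_sum]
  exact Finset.sum_comm

variable {G : SimpleGraph V} {β : ℝ}

theorem pin_eq_of_agree {w : V} {b : V → Fin q → ℝ} {τ τ' : V → Fin q} {u : V}
    (h : G.Adj w u → τ u = τ' u) : pin G β w τ b u = pin G β w τ' b u := by
  ext y
  unfold pin
  split_ifs with ha
  · rw [h ha]
  · rfl

theorem pin_congr {w : V} {b b' : V → Fin q → ℝ} (τ : V → Fin q) {u : V}
    (h : b u = b' u) : pin G β w τ b u = pin G β w τ b' u := by
  ext y
  unfold pin
  rw [h]

variable [Fintype V]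

/-- The condition on a weight function `δ` on the vertices under which the walk sums bound the
decay of correlation. -/
def IsDecayWeight (q : ℕ) (β : ℝ) (G : SimpleGraph V) (δ : V → ℝ) : Prop :=
  ∀ u, 1 ≤ δ u ∨ 0 < (q : ℝ) - 1 - (1 - β) * G.degree u ∧
    2 * (1 - β) / ((q : ℝ) - 1 - (1 - β) * G.degree u) ≤ δ u

theorem IsDecayWeight.nonneg {δ : V → ℝ} (hβ : β ≤ 1) (hδ : IsDecayWeight q β G δ) (u : V) :
    0 ≤ δ u := by
  rcases hδ u with h | ⟨h, h'⟩
  · linarith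
  · exact le_trans (div_nonneg (by linarith) h.le) h'

/-- Here `N` contains the vertices where the fields differ, and `m` is a lower bound for the
distance to it. Walks of length `n` or more do not matter because `U.card < n`. Requiring the sum to
be below `1` excludes `m = 0` and passes to the neighbours whose factor is at least `1`. -/
theorem ratio_le_exp_sum_walkSum [NeZero q] (hβ0 : 0 < β) (hβ1 : β ≤ 1) {δ : V → ℝ}
    (hδ : IsDecayWeight q β G δ) (N : Set V) (n : ℕ) :
    ∀ (m : ℕ) (U : Finset V) (w : V), w ∉ U → U.card < n →
      (∀ u ∈ N, ∀ p : G.Walk w u, m ≤ p.length) →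
      ∑ ℓ ∈ Finset.Ico m n, walkSum G δ ℓ U w < 1 →
      ∀ b₁ b₂ : V → Fin q → ℝ, Admissible G β (insert w U) b₁ → Admissible G β (insert w U) b₂ →
        (∀ u ∉ N, b₁ u = b₂ u) → ∀ x y : Fin q,
        b₁ w x * fieldZ G β U (pin G β w (fun _ => x) b₁) *
            (b₂ w y * fieldZ G β U (pin G β w (fun _ => y) b₂)) ≤
          Real.exp (∑ ℓ ∈ Finset.Ico m n, walkSum G δ ℓ U w) *
            (b₁ w y * fieldZ G β U (pin G β w (fun _ => y) b₁) *
              (b₂ w x * fieldZ G β U (pin G β w (fun _ => x) b₂))) := by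
  have hq : (0 : ℝ) < q := by exact_mod_cast Nat.pos_of_ne_zero (NeZero.ne q)
  have hδ0 : ∀ u, 0 ≤ δ u := hδ.nonneg hβ1
  induction n with
  | zero => intro m U w _ h; exact absurd h (Nat.not_lt_zero _)
  | succ n ih =>
    intro m U w hw hU hN hA b₁ b₂ hb₁ hb₂ hb x y
    -- For `m = 0` the term of length `0` alone contributes `1`.
    obtain _ | m := m
    · exfalso
      have : walkSum G δ 0 U w ≤ ∑ ℓ ∈ Finset.Ico 0 (n + 1), walkSum G δ ℓ U w :=
        Finset.single_le_sum (f := fun ℓ => walkSum G δ ℓ U w)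
          (fun ℓ _ => walkSum_nonneg G hδ0 ℓ U w) (by simp)
      simp only [walkSum] at this
      linarith
    have hwN : w ∉ N := fun h => by simpa using hN w h SimpleGraph.Walk.nil
    rw [sum_Ico_walkSum_succ] at hA ⊢
    set A : V → ℝ := fun u => ∑ ℓ ∈ Finset.Ico m n, walkSum G δ ℓ (U.erase u) u with hAdef
    have hA0 : ∀ u, 0 ≤ A u := fun u => Finset.sum_nonneg fun ℓ _ => walkSum_nonneg G hδ0 _ _ _
    -- Interpolation between the constant colours `x` and `y`: the pendant edges at `S` have been
    -- switched.
    let τ : Finset V → V → Fin q := fun S u => if u ∈ S then y else x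
    have hZpos : ∀ b : V → Fin q → ℝ, Admissible G β (insert w U) b → ∀ σ,
        0 < fieldZ G β U (pin G β w σ b) :=
      fun b hb σ => fieldZ_pos hβ0 fun u hu y => ((hb.pin hβ0 hβ1 hw σ) u hu).1 y |>.1
    have step : ∀ S : Finset V, ∀ u ∈ U, G.Adj w u → u ∉ S →
        fieldZ G β U (pin G β w (τ S) b₁) * fieldZ G β U (pin G β w (τ (insert u S)) b₂) ≤
          Real.exp (δ u * A u) * (fieldZ G β U (pin G β w (τ (insert u S)) b₁) *
            fieldZ G β U (pin G β w (τ S) b₂)) := by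
      intro S u hu hadj huS
      have hins : insert u (U.erase u) = U := Finset.insert_erase hu
      have hue : u ∉ U.erase u := Finset.notMem_erase u U
      -- The pendant edge at `u` is omitted, so that the marginal of `u` is compared before the
      -- switched edge acts on it.
      let B : (V → Fin q → ℝ) → V → Fin q → ℝ :=
        fun b => Function.update (pin G β w (τ S) b) u (b u)
      have hBadm : ∀ b, Admissible G β (insert w U) b → Admissible G β (insert u (U.erase u)) (B b) := by
        intro b hb
        rw [hins]
        refine hb.of_insert hβ0 hβ1 hw fun u' _ => ?_
        by_cases h : u' = u
        · subst h; exact Or.inl (by simp [B])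
        by_cases ha : G.Adj w u'
        · exact Or.inr ⟨ha, τ S u', fun y => by simp [B, h, pin, ha]⟩
        · exact Or.inl (by ext y; simp [B, h, pin, ha])
      let f : (V → Fin q → ℝ) → Fin q → ℝ := fun b z =>
        B b u z * fieldZ G β (U.erase u) (pin G β u (fun _ => z) (B b))
      have hf : ∀ b, Admissible G β (insert w U) b → ∀ z, 0 < f b z := fun b hb z =>
        mul_pos ((hBadm b hb u (Finset.mem_insert_self _ _)).1 z).1
          (fieldZ_pos hβ0 fun v hv y => (((hBadm b hb).pin hβ0 hβ1 hue _) v hv).1 y |>.1)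
      have hsum : ∀ b, Admissible G β (insert w U) b → ∀ z', 0 ≤ ∑ z, agree β z z' * f b z :=
        fun b hb z' => Finset.sum_nonneg fun z _ =>
          mul_nonneg (agree_nonneg hβ0.le _ _) (hf b hb z).le
      have hval : ∀ b σ, (∀ v, v ≠ u → σ v = τ S v) →
          fieldZ G β U (pin G β w σ b) = (q : ℝ)⁻¹ * ∑ z, agree β z (σ u) * f b z := by
        intro b σ hσ
        rw [eq_inv_mul_iff_mul_eq₀ hq.ne']
        conv_lhs => rw [← hins]
        rw [card_mul_fieldZ_insert hue]
        refine Finset.sum_congr rfl fun z _ => ?_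
        have : fieldZ G β (U.erase u) (pin G β u (fun _ => z) (pin G β w σ b)) =
            fieldZ G β (U.erase u) (pin G β u (fun _ => z) (B b)) :=
          fieldZ_congr fun v hv => pin_congr _ (by
            have hvu := Finset.ne_of_mem_erase hv
            simp only [B, Function.update_of_ne hvu]
            exact pin_eq_of_agree fun _ => hσ v hvu)
        rw [this]
        simp [f, B, pin, hadj, mul_assoc]
      rw [hval b₁ (τ S) fun _ _ => rfl, hval b₂ (τ S) fun _ _ => rfl,
        hval b₁ (τ (insert u S)) fun v hv => by simp [τ, hv],
        hval b₂ (τ (insert u S)) fun v hv => by simp [τ, hv]]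
      have hτ1 : τ S u = x := by simp [τ, huS]
      have hτ2 : τ (insert u S) u = y := by simp [τ]
      rw [hτ1, hτ2]
      suffices h : (∑ z, agree β z x * f b₁ z) * (∑ z, agree β z y * f b₂ z) ≤
          Real.exp (δ u * A u) * ((∑ z, agree β z y * f b₁ z) * ∑ z, agree β z x * f b₂ z) by
        have := mul_le_mul_of_nonneg_left h (mul_pos (inv_pos.2 hq) (inv_pos.2 hq)).le
        linarith
      have hrat : A u < 1 → ∀ z z', f b₁ z * f b₂ z' ≤ Real.exp (A u) * (f b₁ z' * f b₂ z) := by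
        intro hAu z z'
        refine ih m (U.erase u) u hue ?_ (fun u' hu' p => ?_) hAu (B b₁) (B b₂) (hBadm b₁ hb₁)
          (hBadm b₂ hb₂) (fun u' hu' => ?_) z z'
        · rw [Finset.card_erase_of_mem hu]
          have := Finset.card_pos.2 ⟨u, hu⟩
          omega
        · have := hN u' hu' (SimpleGraph.Walk.cons hadj p)
          simpa using this
        · by_cases h : u' = u
          · subst h; simpa [B] using hb u' hu'
          · simp only [B, Function.update_of_ne h]
            exact pin_congr _ (hb u' hu')
      rcases hδ u with h1 | ⟨h1, h2⟩
      · have hle : A u ≤ δ u * A u := le_mul_of_one_le_left (hA0 u) h1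
        have hlt : A u < 1 := by
          refine lt_of_le_of_lt (hle.trans ?_) hA
          exact Finset.single_le_sum (f := fun u => δ u * A u)
            (fun v _ => mul_nonneg (hδ0 v) (hA0 v)) (by simp [hu, hadj])
        have := switch_le_of_ratio hβ0.le (hrat hlt) x y
        refine this.trans ?_
        exact mul_le_mul_of_nonneg_right (Real.exp_le_exp.2 hle)
          (mul_nonneg (hsum b₁ hb₁ y) (hsum b₂ hb₂ x))
      · have hm : 1 - β < (q : ℝ) - (1 - β) * G.degree u := by linarith
        have := switch_le_of_marginal_le hβ1 hm (hA0 u) (hf b₁ hb₁) (hf b₂ hb₂)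
          (mul_marginal_le_sum hβ0 hβ1 (hBadm b₁ hb₁) (by linarith))
          (mul_marginal_le_sum hβ0 hβ1 (hBadm b₂ hb₂) (by linarith)) hrat x y
        refine this.trans ?_
        refine mul_le_mul_of_nonneg_right (Real.exp_le_exp.2 ?_)
          (mul_nonneg (hsum b₁ hb₁ y) (hsum b₂ hb₂ x))
        refine mul_le_mul_of_nonneg_right (le_trans ?_ h2) (hA0 u)
        -- The denominator obtained exceeds the one in `IsDecayWeight` by `β`.
        exact div_le_div_of_nonneg_left (by linarith) h1 (by linarith)
    have chain : ∀ S : Finset V, S ⊆ U.filter (G.Adj w) →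
        fieldZ G β U (pin G β w (τ ∅) b₁) * fieldZ G β U (pin G β w (τ S) b₂) ≤
          Real.exp (∑ u ∈ S, δ u * A u) * (fieldZ G β U (pin G β w (τ S) b₁) *
            fieldZ G β U (pin G β w (τ ∅) b₂)) := by
      intro S
      induction S using Finset.induction_on with
      | empty => intro _; simp
      | insert u S huS ihS =>
        intro hS
        have h1 := ihS ((Finset.subset_insert _ _).trans hS)
        have hu := Finset.mem_filter.1 (hS (Finset.mem_insert_self _ _))
        have h2 := step S u hu.1 hu.2 huS
        rw [Finset.sum_insert huS, Real.exp_add]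
        have p1 := hZpos b₁ hb₁ (τ S)
        have p2 := hZpos b₂ hb₂ (τ S)
        have h3 := mul_le_mul h1 h2
          (mul_pos p1 (hZpos b₂ hb₂ _)).le
          (mul_pos (Real.exp_pos _) (mul_pos p1 (hZpos b₂ hb₂ _))).le
        refine le_of_mul_le_mul_right ?_ (mul_pos p1 p2)
        linarith
    have hmain := chain _ subset_rfl
    have hx : ∀ b, fieldZ G β U (pin G β w (τ ∅) b) = fieldZ G β U (pin G β w (fun _ => x) b) :=
      fun b => fieldZ_congr fun u _ => pin_eq_of_agree fun _ => by simp [τ]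
    have hy : ∀ b, fieldZ G β U (pin G β w (τ (U.filter (G.Adj w))) b) =
        fieldZ G β U (pin G β w (fun _ => y) b) :=
      fun b => fieldZ_congr fun u hu => pin_eq_of_agree fun h => by simp [τ, hu, h]
    rw [hx, hx, hy, hy] at hmain
    have hbw := hb w hwN
    have hpos := (hb₁ w (Finset.mem_insert_self _ _)).1
    rw [← hbw]
    have := mul_le_mul_of_nonneg_left hmain (mul_pos (hpos x).1 (hpos y).1).le
    linarith

end Contraction

end Potts

namespace Potts

/-! ### From walk sums to the marginals of an instance. -/

noncomputable section Marginals

open scoped Classical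

variable {V : Type*} {q : ℕ} {G : SimpleGraph V} {β : ℝ}

theorem distToSet_le_length {S : Set V} {v u : V} (hu : u ∈ S) (p : G.Walk v u) :
    distToSet G v S ≤ p.length :=
  (iInf₂_le u hu).trans (SimpleGraph.edist_le p)

variable [Fintype V]

/-- Split off the first step; since `w ∉ U`, prepending `w` to a path inside `U` gives a path again.
-/
theorem walkSum_le_sum_paths (G : SimpleGraph V) {δ : V → ℝ} (hδ : ∀ u, 0 ≤ δ u) (ℓ : ℕ) :
    ∀ (U : Finset V) (w : V), w ∉ U → walkSum G δ ℓ U w ≤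
      ∑ v, ∑ p ∈ G.finsetWalkLength ℓ w v with p.IsPath ∧ ∀ x ∈ p.support.tail, x ∈ U,
        (p.support.tail.map δ).prod := by
  have hprod : ∀ l : List V, 0 ≤ (l.map δ).prod := fun l => List.prod_nonneg (by
    intro a ha
    obtain ⟨u, -, rfl⟩ := List.mem_map.1 ha
    exact hδ u)
  induction ℓ with
  | zero =>
    intro U w _
    have hnil : (SimpleGraph.Walk.nil : G.Walk w w) ∈
        (G.finsetWalkLength 0 w w).filter fun p => p.IsPath ∧ ∀ x ∈ p.support.tail, x ∈ U :=
      Finset.mem_filter.2 ⟨SimpleGraph.mem_finsetWalkLength_iff.2 rfl,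
        SimpleGraph.Walk.IsPath.nil, fun x hx => absurd hx List.not_mem_nil⟩
    calc walkSum G δ 0 U w
        = ((SimpleGraph.Walk.nil : G.Walk w w).support.tail.map δ).prod := by simp [walkSum]
      _ ≤ _ := Finset.single_le_sum (f := fun p : G.Walk w w => (p.support.tail.map δ).prod)
          (fun p _ => hprod _) hnil
      _ ≤ _ := Finset.single_le_sum (f := fun v => ∑ p ∈ G.finsetWalkLength 0 w v with
          p.IsPath ∧ ∀ x ∈ p.support.tail, x ∈ U, (p.support.tail.map δ).prod)
          (fun v _ => Finset.sum_nonneg fun p _ => hprod _) (Finset.mem_univ w)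
  | succ ℓ ih =>
    intro U w hw
    let F : V → V → ℝ := fun v u => if u ∈ U then
      ∑ p ∈ G.finsetWalkLength ℓ u v with p.IsPath ∧ ∀ x ∈ p.support.tail, x ∈ U.erase u,
        δ u * (p.support.tail.map δ).prod else 0
    have hF : ∀ v u, 0 ≤ F v u := fun v u => by
      simp only [F]
      split_ifs
      · exact Finset.sum_nonneg fun p _ => mul_nonneg (hδ u) (hprod _)
      · exact le_rfl
    have h1 : walkSum G δ (ℓ + 1) U w ≤ ∑ v, ∑ u : G.neighborSet w, F v u := by
      simp only [walkSum]
      rw [Finset.sum_comm]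
      have h2 : ∑ u : G.neighborSet w, ∑ v, F v u =
          ∑ u ∈ Finset.univ.filter (G.Adj w), ∑ v, F v u :=
        (Finset.sum_subtype _ (by simp) fun u => ∑ v, F v u).symm
      rw [h2]
      refine (Finset.sum_le_sum (g := fun u => ∑ v, F v u) fun u hu => ?_).trans
        (Finset.sum_le_sum_of_subset_of_nonneg
          (Finset.filter_subset_filter _ (Finset.subset_univ U))
          fun u _ _ => Finset.sum_nonneg fun v _ => hF v u)
      have huU := (Finset.mem_filter.1 hu).1
      refine (mul_le_mul_of_nonneg_left (ih (U.erase u) u (Finset.notMem_erase u U))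
        (hδ u)).trans_eq ?_
      simp only [F, huU, if_true, Finset.mul_sum]
    refine h1.trans (Finset.sum_le_sum fun v _ => ?_)
    rw [Finset.sum_filter]
    simp only [SimpleGraph.finsetWalkLength]
    rw [Finset.sum_biUnion]
    · refine Finset.sum_le_sum fun u _ => ?_
      rw [Finset.sum_map]
      have hadj : G.Adj w u := u.2
      simp only [F]
      split_ifs with huU
      · rw [Finset.sum_filter]
        refine Finset.sum_le_sum fun p _ => ?_
        by_cases hp : p.IsPath ∧ ∀ x ∈ p.support.tail, x ∈ U.erase u.1
        · have hsub : ∀ x ∈ p.support, x ∈ U := by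
            intro x hx
            rw [← p.cons_tail_support, List.mem_cons] at hx
            rcases hx with rfl | hx
            · exact huU
            · exact Finset.mem_of_mem_erase (hp.2 x hx)
          rw [if_pos hp, if_pos]
          · change _ ≤ ((SimpleGraph.Walk.cons hadj p).support.tail.map δ).prod
            rw [SimpleGraph.Walk.support_cons, List.tail_cons]
            rw [← List.prod_cons, ← List.map_cons, p.cons_tail_support]
          · change (SimpleGraph.Walk.cons hadj p).IsPath ∧
              ∀ x ∈ (SimpleGraph.Walk.cons hadj p).support.tail, x ∈ U
            rw [SimpleGraph.Walk.cons_isPath_iff, SimpleGraph.Walk.support_cons, List.tail_cons]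
            exact ⟨⟨hp.1, fun h => hw (hsub w h)⟩, hsub⟩
        · rw [if_neg hp]
          split_ifs
          · exact hprod _
          · exact le_rfl
      · refine Finset.sum_nonneg fun p _ => ?_
        split_ifs
        · exact hprod _
        · exact le_rfl
    · intro u _ u' _ huu'
      refine Finset.disjoint_left.2 fun p hp hp' => huu' ?_
      obtain ⟨r, -, rfl⟩ := Finset.mem_map.1 hp
      obtain ⟨r', -, h⟩ := Finset.mem_map.1 hp'
      exact Subtype.ext (SimpleGraph.Walk.cons.inj h).1.symm

theorem walkSum_le_sawSum (G : SimpleGraph V) {δ : ℕ → ℝ} (hδ : ∀ d, 0 ≤ δ d) (ℓ : ℕ)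
    {U : Finset V} {w : V} (hw : w ∉ U) :
    walkSum G (fun u => δ (G.degree u)) ℓ U w ≤ sawSum G δ w ℓ := by
  refine (walkSum_le_sum_paths G (fun u => hδ _) ℓ U w hw).trans ?_
  unfold sawSum
  refine Finset.sum_le_sum fun v _ => Finset.sum_le_sum_of_subset_of_nonneg ?_ fun p _ _ => ?_
  · exact Finset.monotone_filter_right _ fun p _ hp => hp.1
  · refine List.prod_nonneg fun a ha => ?_
    obtain ⟨u, -, rfl⟩ := List.mem_map.1 ha
    exact hδ _

/-! ### Eliminating the fixed vertices -/

/-- The fields that remain when the vertices of `S` have been given the colours `ρ` and removed. -/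
def pinSet (G : SimpleGraph V) (β : ℝ) (S : Finset V) (ρ : V → Fin q) (b : V → Fin q → ℝ) :
    V → Fin q → ℝ :=
  fun u y => (∏ w ∈ S with G.Adj w u, agree β y (ρ w)) * b u y

/-- The constant collects the interactions inside `S`. Its independence of `U` and `b` is what lets
it cancel in ratios of marginals. -/
theorem fieldZ_union_eq (G : SimpleGraph V) (hβ : 0 < β) (ρ : V → Fin q) (S : Finset V) :
    ∃ C : ℝ, 0 < C ∧ ∀ U : Finset V, Disjoint S U → ∀ b : V → Fin q → ℝ,
      (∀ u ∈ S, ∀ y, b u y = if y = ρ u then 1 else 0) →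
      (q : ℝ) ^ S.card * fieldZ G β (S ∪ U) b = C * fieldZ G β U (pinSet G β S ρ b) := by
  induction S using Finset.induction_on with
  | empty =>
    refine ⟨1, one_pos, fun U _ b _ => ?_⟩
    have : pinSet G β ∅ ρ b = b := by ext u y; simp [pinSet]
    simp [this]
  | insert w S hw ih =>
    obtain ⟨C, hC, h⟩ := ih
    refine ⟨C * ∏ w' ∈ S with G.Adj w' w, agree β (ρ w) (ρ w'),
      mul_pos hC (Finset.prod_pos fun _ _ => agree_pos hβ _ _), fun U hU b hb => ?_⟩
    rw [Finset.disjoint_insert_left] at hU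
    have h1 := h (insert w U) (Finset.disjoint_insert_right.2 ⟨hw, hU.2⟩) b
      fun u hu => hb u (Finset.mem_insert_of_mem hu)
    have hset : insert w S ∪ U = S ∪ insert w U := by ext; simp
    have hpin : pin G β w (fun _ => ρ w) (pinSet G β S ρ b) = pinSet G β (insert w S) ρ b := by
      ext u y
      simp only [pin, pinSet, Finset.filter_insert]
      split_ifs with ha
      · rw [Finset.prod_insert (by simp [hw]), mul_assoc]
      · rfl
    have h2 := card_mul_fieldZ_insert (G := G) (β := β) (b := pinSet G β S ρ b) hU.1
    rw [Finset.sum_eq_single (ρ w)] at h2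
    · have h3 : pinSet G β S ρ b w (ρ w) = ∏ w' ∈ S with G.Adj w' w, agree β (ρ w) (ρ w') := by
        simp [pinSet, hb w (Finset.mem_insert_self _ _)]
      rw [hpin, h3] at h2
      rw [hset, Finset.card_insert_of_notMem hw]
      linear_combination (q : ℝ) * h1 + C * h2
    · intro x _ hx
      simp [pinSet, hb w (Finset.mem_insert_self _ _), hx]
    · simp

/-- An extension of a boundary configuration to all vertices. -/
def extend [NeZero q] {Λ : Set V} (ρ : Λ → Fin q) (u : V) : Fin q :=
  if h : u ∈ Λ then ρ ⟨u, h⟩ else 0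

/-- The fields on the free vertices induced by a boundary configuration. -/
def bdryField [NeZero q] (G : SimpleGraph V) (β : ℝ) {Λ : Set V} (ρ : Λ → Fin q) :
    V → Fin q → ℝ :=
  pinSet G β Λ.toFinset (extend ρ) fun _ _ => 1

theorem weight_eq_fieldWeight [NeZero q] {Λ : Set V} (ρ : Λ → Fin q) {b : V → Fin q → ℝ}
    (hb : ∀ u ∈ Λ, ∀ y, b u y = if y = extend ρ u then 1 else 0)
    (hb' : ∀ u ∉ Λ, ∀ y, b u y = 1) (c : V → Fin q) :
    (Instance.mk G Λ ρ).weight β c = fieldWeight G β Finset.univ b c := by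
  have h1 : ∏ e ∈ G.edgeFinset with ∀ u ∈ e, u ∈ Finset.univ, edgeAgree β c e =
      graphWeight β G c := by
    simp [edgeAgree, graphWeight, numMono, Finset.prod_ite]
  unfold fieldWeight Instance.weight
  rw [h1]
  split_ifs with h
  · rw [Finset.prod_eq_one, one_mul]
    intro u _
    by_cases hu : u ∈ Λ
    · rw [hb u hu, if_pos]
      simpa [extend, hu] using h ⟨u, hu⟩
    · exact hb' u hu _
  · push Not at h
    obtain ⟨u, hu⟩ := h
    rw [Finset.prod_eq_zero (Finset.mem_univ u.1), zero_mul]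
    rw [hb u u.2, if_neg]
    simpa [extend] using hu

theorem sum_weight_eq [NeZero q] (hβ : 0 < β) {Λ : Set V} (ρ : Λ → Fin q) {v : V} (hv : v ∉ Λ) :
    ∃ K : ℝ, 0 < K ∧ ∀ x, ∑ c with c v = x, (Instance.mk G Λ ρ).weight β c =
      K * (bdryField G β ρ v x *
        fieldZ G β (Λ.toFinsetᶜ.erase v) (pin G β v (fun _ => x) (bdryField G β ρ))) := by
  have hq : (0 : ℝ) < q := by exact_mod_cast Nat.pos_of_ne_zero (NeZero.ne q)
  obtain ⟨C, hC, h⟩ := fieldZ_union_eq G hβ (extend ρ) Λ.toFinset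
  refine ⟨C / (q ^ Λ.toFinset.card * q), div_pos hC (by positivity), fun x => ?_⟩
  set U := Λ.toFinsetᶜ.erase v with hU
  have hins : insert v U = Λ.toFinsetᶜ := Finset.insert_erase (by simpa using hv)
  let b₀ : V → Fin q → ℝ := fun u y => if u ∈ Λ then (if y = extend ρ u then 1 else 0) else 1
  -- An indicator field at `v` restricts the partition function to the colourings with `c v = x`.
  let b : V → Fin q → ℝ := Function.update b₀ v fun y => if y = x then 1 else 0
  have hbΛ : ∀ u ∈ Λ, b u = b₀ u := fun u hu =>
    Function.update_of_ne (by rintro rfl; exact hv hu) _ _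
  have h1 : ∑ c with c v = x, (Instance.mk G Λ ρ).weight β c = fieldZ G β Finset.univ b := by
    unfold fieldZ
    rw [Finset.sum_filter]
    refine Finset.sum_congr rfl fun c _ => ?_
    rw [weight_eq_fieldWeight ρ (b := b₀) (fun u hu y => by simp [b₀, hu])
      (fun u hu y => by simp [b₀, hu])]
    unfold fieldWeight
    rw [← Finset.mul_prod_erase _ _ (Finset.mem_univ v),
      ← Finset.mul_prod_erase _ (fun u => b u (c u)) (Finset.mem_univ v)]
    have : ∏ u ∈ Finset.univ.erase v, b u (c u) = ∏ u ∈ Finset.univ.erase v, b₀ u (c u) :=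
      Finset.prod_congr rfl fun u hu => by
        simp only [b, Function.update_of_ne (Finset.ne_of_mem_erase hu)]
    rw [this]
    simp [b, b₀, hv]
  have h2 := h Λ.toFinsetᶜ disjoint_compl_right b fun u hu y => by
    rw [hbΛ u (by simpa using hu)]
    have : u ∈ Λ := by simpa using hu
    simp [b₀, this]
  rw [Finset.union_compl, ← hins] at h2
  have h3 := card_mul_fieldZ_insert (G := G) (β := β) (b := pinSet G β Λ.toFinset (extend ρ) b)
    (Finset.notMem_erase v Λ.toFinsetᶜ)
  rw [← hU, Finset.sum_eq_single x] at h3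
  · have h4 : fieldZ G β U (pin G β v (fun _ => x) (pinSet G β Λ.toFinset (extend ρ) b)) =
        fieldZ G β U (pin G β v (fun _ => x) (bdryField G β ρ)) :=
      fieldZ_congr fun u hu => pin_congr _ (by
        have hu' := Finset.mem_erase.1 hu
        have hu2 : u ∉ Λ := by simpa using hu'.2
        ext y
        simp [pinSet, bdryField, b, b₀, hu'.1, hu2])
    have h5 : pinSet G β Λ.toFinset (extend ρ) b v x = bdryField G β ρ v x := by
      simp [pinSet, bdryField, b]
    rw [h4, h5] at h3
    rw [h1, div_mul_eq_mul_div, eq_div_iff (by positivity)]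
    linear_combination (q : ℝ) * h2 + C * h3
  · intro y _ hy
    simp [pinSet, b, hy]
  · simp

theorem marginal_eq_sum_div (Ω : Instance V q) (v : V) (x : Fin q) :
    Ω.marginal β v x = (∑ c with c v = x, Ω.weight β c) / Ω.partitionFunction β := by
  simp [Instance.marginal, Instance.gibbs, Finset.sum_div]

theorem partitionFunction_eq_sum (Ω : Instance V q) (v : V) :
    Ω.partitionFunction β = ∑ x, ∑ c with c v = x, Ω.weight β c := by
  unfold Instance.partitionFunction
  exact (Finset.sum_fiberwise _ _ _).symm

theorem marginal_eq_div [NeZero q] (hβ : 0 < β) {Λ : Set V} (ρ : Λ → Fin q) {v : V} (hv : v ∉ Λ)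
    (x : Fin q) :
    (Instance.mk G Λ ρ).marginal β v x =
      (bdryField G β ρ v x *
        fieldZ G β (Λ.toFinsetᶜ.erase v) (pin G β v (fun _ => x) (bdryField G β ρ))) /
      ∑ y, bdryField G β ρ v y *
        fieldZ G β (Λ.toFinsetᶜ.erase v) (pin G β v (fun _ => y) (bdryField G β ρ)) := by
  obtain ⟨K, hK, h⟩ := sum_weight_eq (G := G) hβ ρ hv
  rw [marginal_eq_sum_div, partitionFunction_eq_sum _ v]
  simp only [h]
  rw [← Finset.mul_sum, mul_div_mul_left _ _ hK.ne']

theorem admissible_bdryField [NeZero q] (hβ0 : 0 < β) (hβ1 : β ≤ 1) {Λ : Set V} (ρ : Λ → Fin q) :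
    Admissible G β Λ.toFinsetᶜ (bdryField G β ρ) := by
  intro u _
  refine ⟨fun y => ?_, ?_⟩
  · simp only [bdryField, pinSet, mul_one]
    exact ⟨Finset.prod_pos fun _ _ => agree_pos hβ0 _ _,
      Finset.prod_le_one (fun _ _ => agree_nonneg hβ0.le _ _) fun _ _ => agree_le_one hβ1 _ _⟩
  · refine (sum_one_sub_prod_agree_le hβ0.le hβ1 _ (extend ρ) (fun _ => 1) (by simp)
      (by simp)).trans_eq ?_
    have hdeg : G.degree u = (Λ.toFinset.filter fun w => G.Adj w u).card +
        (Λ.toFinsetᶜ.filter (G.Adj u)).card := by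
      rw [← G.card_neighborFinset_eq_degree u,
        ← Finset.card_union_of_disjoint
          (Finset.disjoint_filter_filter disjoint_compl_right)]
      congr 1
      ext w
      simp only [SimpleGraph.mem_neighborFinset, Finset.mem_union, Finset.mem_filter,
        Finset.mem_compl, G.adj_comm w u]
      tauto
    rw [hdeg]
    simp

theorem abs_div_sub_div_le {A p r F H : ℝ} (hF : 0 < F) (hH : 0 < H) (hp : 0 ≤ p) (hr : 0 ≤ r)
    (hpF : p ≤ F) (hrH : r ≤ H) (hA : 0 ≤ A)
    (h1 : p * H ≤ Real.exp A * (F * r)) (h2 : r * F ≤ Real.exp A * (H * p)) :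
    |p / F - r / H| ≤ A := by
  have key : ∀ {p r F H : ℝ}, 0 < F → 0 < H → 0 ≤ p → p ≤ F →
      p * H ≤ Real.exp A * (F * r) → p / F - r / H ≤ A := by
    intro p r F H hF hH hp hpF h
    have h3 : 1 - A ≤ Real.exp (-A) := by linarith [Real.add_one_le_exp (-A)]
    have h4 : Real.exp (-A) * (p * H) ≤ F * r := by
      rw [Real.exp_neg, inv_mul_le_iff₀ (Real.exp_pos A)]; exact h
    have h5 := mul_le_mul_of_nonneg_right h3 (mul_nonneg hp hH.le)
    have h6 := mul_le_mul_of_nonneg_left hpF (mul_nonneg hA hH.le)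
    rw [div_sub_div _ _ hF.ne' hH.ne', div_le_iff₀ (mul_pos hF hH)]
    linarith
  exact abs_sub_le_iff.2 ⟨key hF hH hp hpF h1, key hH hF hr hrH h2⟩

theorem marginal_nonneg (hβ : 0 ≤ β) (Ω : Instance V q) (v : V) (x : Fin q) :
    0 ≤ Ω.marginal β v x := by
  have hw : ∀ c, 0 ≤ Ω.weight β c := fun c => by
    unfold Instance.weight graphWeight; split_ifs <;> positivity
  rw [marginal_eq_sum_div]
  exact div_nonneg (Finset.sum_nonneg fun c _ => hw c) (Finset.sum_nonneg fun c _ => hw c)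

theorem marginal_le_one (hβ : 0 ≤ β) (Ω : Instance V q) (v : V) (x : Fin q) :
    Ω.marginal β v x ≤ 1 := by
  have hw : ∀ c, 0 ≤ Ω.weight β c := fun c => by
    unfold Instance.weight graphWeight; split_ifs <;> positivity
  rw [marginal_eq_sum_div]
  exact div_le_one_of_le₀ (Finset.sum_le_sum_of_subset_of_nonneg (Finset.filter_subset _ _)
    fun c _ _ => hw c) (Finset.sum_nonneg fun c _ => hw c)

theorem abs_marginal_sub_le_one (hβ : 0 ≤ β) (Ω Ω' : Instance V q) (v : V) (x : Fin q) :
    |Ω.marginal β v x - Ω'.marginal β v x| ≤ 1 := by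
  have h1 := marginal_nonneg hβ Ω v x
  have h2 := marginal_nonneg hβ Ω' v x
  have h3 := marginal_le_one hβ Ω v x
  have h4 := marginal_le_one hβ Ω' v x
  rw [abs_le]; constructor <;> linarith

theorem abs_marginal_sub_le_of_pos [NeZero q] (hβ0 : 0 < β) (hβ1 : β ≤ 1) {δ : ℕ → ℝ}
    (hδ0 : ∀ d, 0 ≤ δ d) (hδ : IsDecayWeight q β G fun u => δ (G.degree u)) {Λ : Set V}
    (ρ π : Λ → Fin q) {v : V} (hv : v ∉ Λ) {m : ℕ}
    (hm : ∀ u ∈ disagreement ρ π, ∀ p : G.Walk v u, m + 1 ≤ p.length) (x : Fin q) :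
    |(Instance.mk G Λ ρ).marginal β v x - (Instance.mk G Λ π).marginal β v x| ≤
      ∑ ℓ ∈ Finset.Ico m (Fintype.card V), sawSum G δ v ℓ := by
  set U := Λ.toFinsetᶜ.erase v with hU
  have hvU : v ∉ U := Finset.notMem_erase _ _
  have hins : insert v U = Λ.toFinsetᶜ := Finset.insert_erase (by simpa using hv)
  refine le_trans ?_ (Finset.sum_le_sum fun ℓ _ => walkSum_le_sawSum G hδ0 ℓ hvU)
  set A := ∑ ℓ ∈ Finset.Ico m (Fintype.card V), walkSum G (fun u => δ (G.degree u)) ℓ U v with hA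
  rcases le_or_gt 1 A with h1 | h1
  · exact (abs_marginal_sub_le_one hβ0.le _ _ _ _).trans h1
  have hA0 : 0 ≤ A := Finset.sum_nonneg fun ℓ _ => walkSum_nonneg G (fun u => hδ0 _) _ _ _
  have hcard : U.card < Fintype.card V :=
    Finset.card_lt_univ_of_notMem hvU
  -- After deletion of the fixed vertices the fields differ only next to a disagreement, hence one
  -- step closer to `v`.
  let N : Set V := {u | ∃ w ∈ disagreement ρ π, G.Adj w u}
  have hN : ∀ u ∈ N, ∀ p : G.Walk v u, m ≤ p.length := by
    rintro u ⟨w, hw, ha⟩ p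
    have := hm w hw (p.concat ha.symm)
    simpa using this
  have hadm : ∀ σ : Λ → Fin q, Admissible G β (insert v U) (bdryField G β σ) := fun σ => by
    rw [hins]; exact admissible_bdryField hβ0 hβ1 σ
  have hagree : ∀ u ∉ N, bdryField G β ρ u = bdryField G β π u := by
    intro u hu
    ext y
    simp only [bdryField, pinSet]
    congr 1
    refine Finset.prod_congr rfl fun w hw => ?_
    rw [Finset.mem_filter, Set.mem_toFinset] at hw
    congr 1
    by_contra hne
    refine hu ⟨w, ⟨hw.1, fun h => hne ?_⟩, hw.2⟩
    simpa [extend, hw.1] using h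
  have hpos : ∀ (σ : Λ → Fin q) (y : Fin q), 0 < bdryField G β σ v y *
      fieldZ G β U (pin G β v (fun _ => y) (bdryField G β σ)) := fun σ y =>
    mul_pos ((hadm σ v (Finset.mem_insert_self _ _)).1 y).1
      (fieldZ_pos hβ0 fun u hu z => (((hadm σ).pin hβ0 hβ1 hvU _) u hu).1 z |>.1)
  have hR := ratio_le_exp_sum_walkSum hβ0 hβ1 hδ N (Fintype.card V) m U v hvU hcard hN h1
  have hR1 := hR _ _ (hadm ρ) (hadm π) hagree
  have hR2 := hR _ _ (hadm π) (hadm ρ) fun u hu => (hagree u hu).symm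
  rw [marginal_eq_div hβ0 ρ hv, marginal_eq_div hβ0 π hv, ← hU]
  refine abs_div_sub_div_le (Finset.sum_pos (fun y _ => hpos ρ y) ⟨x, Finset.mem_univ _⟩)
    (Finset.sum_pos (fun y _ => hpos π y) ⟨x, Finset.mem_univ _⟩) (hpos ρ x).le (hpos π x).le
    ?_ ?_ hA0 ?_ ?_
  · exact Finset.single_le_sum (f := fun y => bdryField G β ρ v y *
      fieldZ G β U (pin G β v (fun _ => y) (bdryField G β ρ))) (fun y _ => (hpos ρ y).le)
      (Finset.mem_univ x)
  · exact Finset.single_le_sum (f := fun y => bdryField G β π v y *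
      fieldZ G β U (pin G β v (fun _ => y) (bdryField G β π))) (fun y _ => (hpos π y).le)
      (Finset.mem_univ x)
  · rw [Finset.mul_sum, Finset.sum_mul, Finset.mul_sum]
    exact Finset.sum_le_sum fun y _ => hR1 x y
  · rw [Finset.mul_sum, Finset.sum_mul, Finset.mul_sum]
    exact Finset.sum_le_sum fun y _ => hR2 x y

/-! ### Zero temperature as a limit -/

theorem continuous_weight (Ω : Instance V q) (c : V → Fin q) :
    Continuous fun β => Ω.weight β c := by
  unfold Instance.weight graphWeight
  split_ifs
  · exact continuous_pow _
  · exact continuous_const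

theorem partitionFunction_pos (hβ : 0 ≤ β) {Ω : Instance V q} (h : Ω.Feasible β) :
    0 < Ω.partitionFunction β := by
  obtain ⟨c, hc⟩ := h
  refine Finset.sum_pos' (fun c _ => ?_) ⟨c, Finset.mem_univ _, hc⟩
  unfold Instance.weight graphWeight; split_ifs <;> positivity

theorem continuousAt_marginal (hβ : 0 ≤ β) {Ω : Instance V q} (h : Ω.Feasible β) (v : V)
    (x : Fin q) : ContinuousAt (fun β => Ω.marginal β v x) β := by
  simp only [marginal_eq_sum_div]
  refine ContinuousAt.div ?_ ?_ (partitionFunction_pos hβ h).ne'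
  · exact (continuous_finsetSum _ fun c _ => continuous_weight Ω c).continuousAt
  · exact (continuous_finsetSum _ fun c _ => continuous_weight Ω c).continuousAt

/-- The contraction factor decreases in the activity, so one weight serves all activities
approaching `β` from above. -/
theorem isDecayWeight_delta {β' : ℝ} (hβ : β < 1) (h : β ≤ β') :
    IsDecayWeight q β' G fun u => delta q β (G.degree u) := by
  intro u
  simp only [delta]
  split_ifs with hd
  · right
    have h1 : 0 < 1 - β := by linarith
    have h2 : (G.degree u : ℝ) + 2 ≤ ((q : ℝ) - 1) / (1 - β) := by linarith
    rw [le_div_iff₀ h1] at h2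
    have h3 : (1 - β') * (G.degree u : ℝ) ≤ (1 - β) * G.degree u := by
      gcongr
    have h4 : 0 < (q : ℝ) - 1 - (1 - β) * G.degree u := by linarith
    exact ⟨by linarith, div_le_div₀ (by linarith) (by linarith) h4 (by linarith)⟩
  · exact Or.inl le_rfl

theorem abs_marginal_sub_le [NeZero q] (hβ0 : 0 ≤ β) (hβ1 : β < 1) {Λ : Set V}
    {ρ π : Λ → Fin q} (hρ : (Instance.mk G Λ ρ).Feasible β) (hπ : (Instance.mk G Λ π).Feasible β)
    {v : V} (hv : v ∉ Λ) {m : ℕ}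
    (hm : ∀ u ∈ disagreement ρ π, ∀ p : G.Walk v u, m + 1 ≤ p.length) (x : Fin q) :
    |(Instance.mk G Λ ρ).marginal β v x - (Instance.mk G Λ π).marginal β v x| ≤
      ∑ ℓ ∈ Finset.Ico m (Fintype.card V), sawSum G (delta q β) v ℓ := by
  have hlim : Filter.Tendsto (fun β => |(Instance.mk G Λ ρ).marginal β v x -
      (Instance.mk G Λ π).marginal β v x|) (nhdsWithin β (Set.Ioi β)) (nhds
        |(Instance.mk G Λ ρ).marginal β v x - (Instance.mk G Λ π).marginal β v x|) :=
    ((continuousAt_marginal hβ0 hρ v x).sub (continuousAt_marginal hβ0 hπ v x)).abs.mono_left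
      nhdsWithin_le_nhds
  refine le_of_tendsto hlim ?_
  filter_upwards [Ioo_mem_nhdsGT hβ1] with β' hβ'
  exact abs_marginal_sub_le_of_pos (hβ0.trans_lt hβ'.1) hβ'.2.le
    (fun d => (delta_pos q β hβ1 d).le) (isDecayWeight_delta hβ1 hβ'.1.le) ρ π hv hm x

theorem marginal_of_mem {Ω : Instance V q} (hβ : 0 ≤ β) (h : Ω.Feasible β) {v : V}
    (hv : v ∈ Ω.fixed) (x : Fin q) :
    Ω.marginal β v x = if Ω.bdry ⟨v, hv⟩ = x then 1 else 0 := by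
  have hw : ∀ c, c v ≠ Ω.bdry ⟨v, hv⟩ → Ω.weight β c = 0 := fun c hc => by
    unfold Instance.weight
    exact if_neg fun h' => hc (h' ⟨v, hv⟩)
  rw [marginal_eq_sum_div]
  split_ifs with hx
  · rw [div_eq_one_iff_eq (partitionFunction_pos hβ h).ne']
    unfold Instance.partitionFunction
    rw [Finset.sum_filter]
    refine Finset.sum_congr rfl fun c _ => ?_
    split_ifs with hc
    · rfl
    · exact (hw c (by rw [hx]; exact hc)).symm
  · rw [Finset.sum_eq_zero, zero_div]
    intro c hc
    exact hw c (by rw [(Finset.mem_filter.1 hc).2]; exact Ne.symm hx)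

/-! ### Decay in the distance -/

theorem abs_marginal_sub_le_powDecay [NeZero q] (hβ0 : 0 ≤ β) (hβ1 : β < 1) {C γ : ℝ} (hC : 0 < C)
    (hγ0 : 0 < γ) (hγ1 : γ < 1) {K : ℕ} (hK : 1 / (γ * (1 - γ)) ≤ 2 ^ K)
    (hsaw : ∀ (v : V) (ℓ : ℕ), 1 ≤ ℓ →
      sawSum G (delta q β) v ℓ < (Fintype.card V : ℝ) ^ C * γ ^ ℓ)
    {Λ : Set V} {ρ π : Λ → Fin q} (hρ : (Instance.mk G Λ ρ).Feasible β)
    (hπ : (Instance.mk G Λ π).Feasible β) {v : V} (hv : v ∉ Λ) (x : Fin q) :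
    |(Instance.mk G Λ ρ).marginal β v x - (Instance.mk G Λ π).marginal β v x| ≤
      (Fintype.card V : ℝ) ^ (C + K) * powDecay γ (distToSet G v (disagreement ρ π)) := by
  set D := distToSet G v (disagreement ρ π) with hD
  unfold powDecay
  split_ifs with htop
  -- With this `m` the sum over lengths is empty, so the marginals coincide.
  · have := abs_marginal_sub_le hβ0 hβ1 hρ hπ hv (m := Fintype.card V) (fun u hu p => by
      have := distToSet_le_length hu p
      rw [← hD, htop, top_le_iff] at this
      exact absurd this (by simp)) x
    simpa using this
  obtain ⟨d, hd⟩ := ENat.ne_top_iff_exists.1 htop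
  -- A disagreement lies in `Λ` and `v` does not; two vertices suffice to absorb the constant `1 /
  -- (γ * (1 - γ))` into `n ^ K`.
  have hn : 2 ≤ Fintype.card V := by
    by_contra hcard
    have hsub : Subsingleton V := Fintype.card_le_one_iff_subsingleton.1 (by omega)
    refine htop ?_
    rw [hD, distToSet]
    refine iInf₂_eq_top.2 fun u hu => ?_
    obtain ⟨huΛ, -⟩ := hu
    exact absurd huΛ (by rwa [Subsingleton.elim u v])
  have hn2 : (2 : ℝ) ≤ Fintype.card V := by exact_mod_cast hn
  have hn1 : (1 : ℝ) ≤ Fintype.card V := by linarith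
  have hγ' : 0 < 1 - γ := by linarith
  have hnK : 1 / (γ * (1 - γ)) ≤ (Fintype.card V : ℝ) ^ K := hK.trans (by gcongr)
  have hnC : 1 ≤ (Fintype.card V : ℝ) ^ C := Real.one_le_rpow hn1 hC.le
  rw [← hd, ENat.toNat_natCast, Real.rpow_add (by linarith), Real.rpow_natCast]
  -- The walk sums start at length `d - 1`, and the contraction bound requires length at least `1`;
  -- smaller `d` is covered by the trivial bound.
  rcases Nat.lt_or_ge d 2 with h2 | h2
  · refine (abs_marginal_sub_le_one hβ0 _ _ _ _).trans ?_
    have h3 : γ ≤ γ ^ d := by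
      calc γ = γ ^ 1 := (pow_one γ).symm
        _ ≤ γ ^ d := pow_le_pow_of_le_one hγ0.le hγ1.le (by omega)
    have h4 : 1 ≤ (Fintype.card V : ℝ) ^ K * γ := by
      rw [div_le_iff₀ (mul_pos hγ0 hγ')] at hnK
      have : 0 < (Fintype.card V : ℝ) ^ K * γ := by positivity
      nlinarith
    calc (1 : ℝ) ≤ (Fintype.card V : ℝ) ^ K * γ := h4
      _ ≤ (Fintype.card V : ℝ) ^ K * γ ^ d := by gcongr
      _ ≤ (Fintype.card V : ℝ) ^ C * ((Fintype.card V : ℝ) ^ K * γ ^ d) :=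
        le_mul_of_one_le_left (by positivity) hnC
      _ = _ := by ring
  · obtain ⟨m, rfl⟩ : ∃ m, d = m + 1 := ⟨d - 1, by omega⟩
    have := abs_marginal_sub_le hβ0 hβ1 hρ hπ hv (m := m) (fun u hu p => by
      have := distToSet_le_length hu p
      rw [← hD, ← hd] at this
      exact_mod_cast this) x
    refine this.trans ?_
    calc ∑ ℓ ∈ Finset.Ico m (Fintype.card V), sawSum G (delta q β) v ℓ
        ≤ ∑ ℓ ∈ Finset.Ico m (Fintype.card V), (Fintype.card V : ℝ) ^ C * γ ^ ℓ :=
          Finset.sum_le_sum fun ℓ hℓ => (hsaw v ℓ (by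
            have := (Finset.mem_Ico.1 hℓ).1
            omega)).le
      _ ≤ (Fintype.card V : ℝ) ^ C * (γ ^ m / (1 - γ)) := by
          rw [← Finset.mul_sum]
          gcongr
          exact geom_sum_Ico_le_of_lt_one hγ0.le hγ1
      _ = (Fintype.card V : ℝ) ^ C * (1 / (γ * (1 - γ))) * γ ^ (m + 1) := by
          field_simp
          ring
      _ ≤ _ := by gcongr

theorem expDecay_neg_log {γ : ℝ} (hγ : 0 < γ) (ℓ : ℕ∞) :
    expDecay (-Real.log γ) ℓ = powDecay γ ℓ := by
  unfold expDecay powDecay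
  split_ifs
  · rfl
  · rw [neg_mul, neg_neg, mul_comm, Real.exp_nat_mul, Real.exp_log hγ]

end Marginals

end Potts

theorem theorem1 (q : ℕ) (hq : 3 ≤ q) (β : ℝ) (hβ0 : 0 ≤ β) (hβ1 : β < 1)
    {ι : Type*} {V : ι → Type*} [∀ i, Fintype (V i)] (G : ∀ i, SimpleGraph (V i))
    (hδ : Potts.IsContractionFunction (Potts.delta q β) G)
    (hcol : β = 0 → ∀ i, (G i).Colorable q) :
    Potts.StrongSpatialMixing q β G ∧
    ∃ C₁ C₂ : ℝ, 0 < C₁ ∧ 0 < C₂ ∧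
      ∀ (i : ι) (v : V i) (x : Fin q) (Λ : Set (V i)), v ∉ Λ → ∀ (ρ π : Λ → Fin q),
        (Potts.Instance.mk (G i) Λ ρ).Feasible β → (Potts.Instance.mk (G i) Λ π).Feasible β →
        |(Potts.Instance.mk (G i) Λ ρ).marginal β v x -
            (Potts.Instance.mk (G i) Λ π).marginal β v x| ≤
          (Fintype.card (V i) : ℝ) ^ C₁ *
            Potts.expDecay C₂ (Potts.distToSet (G i) v (Potts.disagreement ρ π)) := by
  have : NeZero q := ⟨by omega⟩
  obtain ⟨-, C, γ, hC, hγ0, hγ1, hsaw⟩ := hδ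
  obtain ⟨K, hK⟩ := pow_unbounded_of_one_lt (1 / (γ * (1 - γ))) (one_lt_two (α := ℝ))
  have hCK : 0 < C + K := by positivity
  refine ⟨⟨C + K, γ, hCK, hγ0, hγ1, ?_⟩, C + K, -Real.log γ, hCK,
    neg_pos.2 (Real.log_neg hγ0 hγ1), ?_⟩
  · intro i v Λ x σ τ hσ hτ
    -- At a fixed vertex the marginals are deterministic: they agree, or the distance is `0` and the
    -- bound is at least `1`.
    by_cases hv : v ∈ Λ
    · by_cases hvΔ : v ∈ Potts.disagreement σ τ
      · refine (Potts.abs_marginal_sub_le_one hβ0 _ _ _ _).trans ?_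
        have hdist : Potts.distToSet (G i) v (Potts.disagreement σ τ) = 0 :=
          le_antisymm (by
            simpa using Potts.distToSet_le_length hvΔ (SimpleGraph.Walk.nil' (G := G i) v))
            bot_le
        have hcard : (1 : ℝ) ≤ Fintype.card (V i) := by
          exact_mod_cast Fintype.card_pos_iff.2 ⟨v⟩
        simpa [hdist, Potts.powDecay] using Real.one_le_rpow hcard hCK.le
      · have heq : σ ⟨v, hv⟩ = τ ⟨v, hv⟩ := by
          by_contra h
          exact hvΔ ⟨hv, h⟩
        rw [Potts.marginal_of_mem hβ0 hσ hv, Potts.marginal_of_mem hβ0 hτ hv]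
        simp only [heq, sub_self, abs_zero]
        unfold Potts.powDecay
        split_ifs <;> positivity
    · exact Potts.abs_marginal_sub_le_powDecay hβ0 hβ1 hC hγ0 hγ1 hK.le (hsaw i) hσ hτ hv x
  · intro i v x Λ hv ρ π hρ hπ
    rw [Potts.expDecay_neg_log hγ0]
    exact Potts.abs_marginal_sub_le_powDecay hβ0 hβ1 hC hγ0 hγ1 hK.le (hsaw i) hρ hπ hv x
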